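/- Let $n,p,m\ge 0$ be integers, let $A\in\mathbb{R}^{n\times n}$, $B\in\mathbb{R}^{n\times p}$, $C\in\mathbb{R}^{m\times n}$, let $T>0$, and let $P_0\in\mathbb{R}^{n\times n}$ be symmetric and non-negative (positive semidefinite). For $\tau\in[0,T]$, $\xi\in\mathbb{R}^n$ and $u\in L^2((\tau,T);\mathbb{R}^p)$ let $x$ be the solution on $[\tau,T]$ of $x'=Ax+Bu$, $x(\tau)=\xi$, that is, the continuous function with $x(t)=\xi+\int_\tau^t\big(Ax(s)+Bu(s)\big)\,ds$ for all $t\in[\tau,T]$, and set $$J_{\tau,T}(x,u)=\int_\tau^T\big(\|Cx(s)\|^2+\|u(s)\|^2\big)\,ds+\langle P_0x(T),x(T)\rangle .$$ Then for every $\tau\in[0,T]$ there is exactly one symmetric matrix $P_T(\tau)\in\mathbb{R}^{n\times n}$ such that $$\langle P_T(\tau)\xi,\xi\rangle=\inf_{u\in L^2((\tau,T);\mathbb{R}^p)}J_{\tau,T}(x,u)\qquad\text{for all }\xi\in\mathbb{R}^n,$$ and the function $P_T$ so defined is differentiable on $[0,T]$ (one-sidedly at the end points) and satisfies $$P_T'+P_TA+A^\top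 P_T-P_TBB^\top P_T+C^\top C=0\quad\text{in }[0,T],\qquad P_T(T)=P_0 .$$ -/

import Mathlib

open MeasureTheory Set

/-- `x` is the solution on `[τ, T]` of `x' = A x + B u`, `x(τ) = ξ`: it is continuous there and
satisfies the integrated equation. -/
def IsLQTrajectory {n p : ℕ} (A : Matrix (Fin n) (Fin n) ℝ) (B : Matrix (Fin n) (Fin p) ℝ)
    (τ T : ℝ) (ξ : EuclideanSpace ℝ (Fin n))
    (u : ℝ → EuclideanSpace ℝ (Fin p)) (x : ℝ → EuclideanSpace ℝ (Fin n)) : Prop :=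
  ContinuousOn x (Icc τ T) ∧
    ∀ t ∈ Icc τ T,
      x t = ξ + ∫ s in τ..t, (Matrix.toEuclideanLin A (x s) + Matrix.toEuclideanLin B (u s))

/-- The cost `J_{τ,T}(x, u) = ∫_τ^T (‖C x‖² + ‖u‖²) ds + ⟨P₀ x(T), x(T)⟩`. -/
noncomputable def lqCost {n p m : ℕ} (C : Matrix (Fin m) (Fin n) ℝ)
    (P₀ : Matrix (Fin n) (Fin n) ℝ) (τ T : ℝ)
    (x : ℝ → EuclideanSpace ℝ (Fin n)) (u : ℝ → EuclideanSpace ℝ (Fin p)) : ℝ :=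
  (∫ s in τ..T, (‖Matrix.toEuclideanLin C (x s)‖ ^ 2 + ‖u s‖ ^ 2)) +
    inner ℝ (Matrix.toEuclideanLin P₀ (x T)) (x T)

/-- All costs `J_{τ,T}(x, u)`, for `u ∈ L²((τ, T); ℝᵖ)` and `x` the solution of
`x' = A x + B u`, `x(τ) = ξ`. For `τ = T` the only cost is `⟨P₀ ξ, ξ⟩`. -/
def lqCosts {n p m : ℕ} (A : Matrix (Fin n) (Fin n) ℝ) (B : Matrix (Fin n) (Fin p) ℝ)
    (C : Matrix (Fin m) (Fin n) ℝ) (P₀ : Matrix (Fin n) (Fin n) ℝ) (τ T : ℝ)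
    (ξ : EuclideanSpace ℝ (Fin n)) : Set ℝ :=
  {c | ∃ (u : ℝ → EuclideanSpace ℝ (Fin p)) (x : ℝ → EuclideanSpace ℝ (Fin n)),
    MemLp u 2 (volume.restrict (Ioo τ T)) ∧ IsLQTrajectory A B τ T ξ u x ∧
      c = lqCost C P₀ τ T x u}

/-- `Q` is the value matrix at time `τ` of the linear quadratic problem with horizon `T`: it is
symmetric, and `⟨Q ξ, ξ⟩` is the infimum of the costs from `ξ` at time `τ`, for every `ξ`. -/
def IsLQValueMatrix {n p m : ℕ} (A : Matrix (Fin n) (Fin n) ℝ) (B : Matrix (Fin n) (Fin p) ℝ)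
    (C : Matrix (Fin m) (Fin n) ℝ) (P₀ : Matrix (Fin n) (Fin n) ℝ) (τ T : ℝ)
    (Q : Matrix (Fin n) (Fin n) ℝ) : Prop :=
  Q.IsSymm ∧ ∀ ξ : EuclideanSpace ℝ (Fin n),
    IsGLB (lqCosts A B C P₀ τ T ξ) (inner ℝ (Matrix.toEuclideanLin Q ξ) ξ)

/-! The Riccati equation is linearised by the Hamiltonian system X' = AX - BBᵀY, Y' = -CᵀCX - AᵀY
with X(T) = 1, Y(T) = P₀, which is solvable on all of ℝ. Everything reduces to showing that YX⁻¹ is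
the value matrix. X is invertible up to time T because P₀ ≥ 0 (`hamiltonian_isUnit`), and YX⁻¹ is
symmetric because XᵀY is. For given ξ, the paths w = X X(τ)⁻¹ξ and y = Y X(τ)⁻¹ξ satisfy the
first-order optimality conditions with control -Bᵀy. The cost is convex and quadratic, so these
conditions suffice: completing the square gives a minimum, of value ⟨y(τ), ξ⟩ (`isLeast_lqCosts`).
No separate existence argument for minimisers is needed. A symmetric matrix is determined by its
quadratic form, so any P as in the theorem equals YX⁻¹ on [0,T]; differentiating this quotient gives
the Riccati equation. -/

theorem Matrix.inner_toEuclideanLin_left {k l : ℕ} (M : Matrix (Fin k) (Fin l) ℝ)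
    (v : EuclideanSpace ℝ (Fin l)) (w : EuclideanSpace ℝ (Fin k)) :
    inner ℝ (Matrix.toEuclideanLin M v) w = inner ℝ v (Matrix.toEuclideanLin M.transpose w) := by
  rw [← Matrix.conjTranspose_eq_transpose_of_trivial,
    Matrix.toEuclideanLin_conjTranspose_eq_adjoint, LinearMap.adjoint_inner_right]

theorem Matrix.toEuclideanLin_mul_apply {k l r : ℕ} (M : Matrix (Fin k) (Fin l) ℝ)
    (N : Matrix (Fin l) (Fin r) ℝ) (v : EuclideanSpace ℝ (Fin r)) :
    Matrix.toEuclideanLin (M * N) v = Matrix.toEuclideanLin M (Matrix.toEuclideanLin N v) := by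
  simp [Matrix.toLpLin_apply, Matrix.mulVec_mulVec]

theorem Matrix.toEuclideanLin_one_apply {k : ℕ} (v : EuclideanSpace ℝ (Fin k)) :
    Matrix.toEuclideanLin (1 : Matrix (Fin k) (Fin k) ℝ) v = v := by
  simp

theorem Matrix.PosSemidef.inner_toEuclideanLin_nonneg {k : ℕ} {M : Matrix (Fin k) (Fin k) ℝ}
    (hM : M.PosSemidef) (v : EuclideanSpace ℝ (Fin k)) :
    0 ≤ inner ℝ (Matrix.toEuclideanLin M v) v := by
  simpa [Matrix.toLpLin_apply, EuclideanSpace.inner_eq_star_dotProduct] using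
    hM.dotProduct_mulVec_nonneg v.ofLp

theorem Matrix.continuous_toEuclideanLin {k l : ℕ} (M : Matrix (Fin k) (Fin l) ℝ) :
    Continuous (Matrix.toEuclideanLin M) :=
  LinearMap.continuous_of_finiteDimensional _

/-- The derivative of `s ↦ M(s) v`. -/
theorem Matrix.hasDerivAt_toEuclideanLin_apply {k l : ℕ} {M : ℝ → Matrix (Fin k) (Fin l) ℝ}
    {M' : Matrix (Fin k) (Fin l) ℝ} {t : ℝ} (h : ∀ i j, HasDerivAt (fun s => M s i j) (M' i j) t)
    (v : EuclideanSpace ℝ (Fin l)) :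
    HasDerivAt (fun s => Matrix.toEuclideanLin (M s) v) (Matrix.toEuclideanLin M' v) t := by
  rw [hasDerivAt_iff_hasFDerivAt, ← hasFDerivWithinAt_univ, hasFDerivWithinAt_euclidean]
  intro i
  rw [hasFDerivWithinAt_univ]
  refine HasDerivAt.hasFDerivAt (f' := Matrix.toEuclideanLin M' v i) ?_ |>.congr_fderiv ?_
  swap
  · ext; simp
  simp only [Matrix.toLpLin_apply, Matrix.mulVec, dotProduct]
  exact HasDerivAt.fun_sum fun j _ => (h i j).mul_const _

/-! ### Integration by parts for primitives -/

/-- The product rule, in integrated form, for primitives of integrable functions. -/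
theorem integral_mul_add_mul_of_primitive {a b f g : ℝ → ℝ} {τ T : ℝ} (hτ : τ ≤ T)
    (hf : IntervalIntegrable f volume τ T) (hg : IntervalIntegrable g volume τ T)
    (ha : ∀ t ∈ Icc τ T, a t = a τ + ∫ s in τ..t, f s)
    (hb : ∀ t ∈ Icc τ T, b t = b τ + ∫ s in τ..t, g s) :
    ∫ s in τ..T, (f s * b s + a s * g s) = a T * b T - a τ * b τ := by
  -- Controls are only L², so trajectories are differentiable only almost everywhere; absolute
  -- continuity is what justifies the product rule.
  have key : ∀ {h : ℝ → ℝ} (c : ℝ), IntervalIntegrable h volume τ T →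
      AbsolutelyContinuousOnInterval (fun t => c + ∫ s in τ..t, h s) τ T ∧
      ∀ᵐ t, t ∈ uIcc τ T → deriv (fun t => c + ∫ s in τ..t, h s) t = h t := by
    intro h c hh
    constructor
    · have hc : AbsolutelyContinuousOnInterval (fun _ : ℝ => c) τ T :=
        (LipschitzWith.const c).lipschitzOnWith.absolutelyContinuousOnInterval
      exact hc.fun_add (hh.absolutelyContinuousOnInterval_intervalIntegral (by simp))
    · filter_upwards [hh.ae_hasDerivAt_integral] with t ht hmem
      exact ((ht hmem τ (by simp)).const_add c).deriv
  obtain ⟨hA, hA'⟩ := key (a τ) hf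
  obtain ⟨hB, hB'⟩ := key (b τ) hg
  have := hA.integral_deriv_mul_eq_sub hB
  rw [← ha T ⟨hτ, le_rfl⟩, ← hb T ⟨hτ, le_rfl⟩] at this
  simp only [intervalIntegral.integral_same, add_zero] at this
  rw [← this]
  apply intervalIntegral.integral_congr_ae
  filter_upwards [hA', hB'] with t h1 h2 hmem
  have hm := uIoc_subset_uIcc hmem
  rw [h1 hm, h2 hm]
  rw [uIcc_of_le hτ] at hm
  rw [ha t hm, hb t hm]

theorem integral_inner_add_inner_of_primitive {k : ℕ} {a b f g : ℝ → EuclideanSpace ℝ (Fin k)}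
    {τ T : ℝ} (hτ : τ ≤ T)
    (hf : IntervalIntegrable f volume τ T) (hg : IntervalIntegrable g volume τ T)
    (ha : ∀ t ∈ Icc τ T, a t = a τ + ∫ s in τ..t, f s)
    (hb : ∀ t ∈ Icc τ T, b t = b τ + ∫ s in τ..t, g s)
    (hac : ContinuousOn a (Icc τ T)) (hbc : ContinuousOn b (Icc τ T)) :
    ∫ s in τ..T, (inner ℝ (f s) (b s) + inner ℝ (a s) (g s))
      = inner ℝ (a T) (b T) - inner ℝ (a τ) (b τ) := by
  have hcoord : ∀ {h : ℝ → EuclideanSpace ℝ (Fin k)} (i : Fin k),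
      IntervalIntegrable h volume τ T → IntervalIntegrable (fun s => h s i) volume τ T :=
    fun i hh => ⟨(EuclideanSpace.proj (𝕜 := ℝ) i).integrable_comp hh.1,
      (EuclideanSpace.proj (𝕜 := ℝ) i).integrable_comp hh.2⟩
  have hprim : ∀ {c h : ℝ → EuclideanSpace ℝ (Fin k)} (i : Fin k),
      IntervalIntegrable h volume τ T → (∀ t ∈ Icc τ T, c t = c τ + ∫ s in τ..t, h s) →
      ∀ t ∈ Icc τ T, c t i = c τ i + ∫ s in τ..t, h s i := by
    intro c h i hh hc t ht
    have hsub : IntervalIntegrable h volume τ t :=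
      hh.mono_set (by rw [uIcc_of_le hτ, uIcc_of_le ht.1]; exact Icc_subset_Icc_right ht.2)
    have := (EuclideanSpace.proj (𝕜 := ℝ) i).intervalIntegral_comp_comm hsub
    simp only [PiLp.proj_apply] at this
    rw [this]
    conv_lhs => rw [hc t ht]
    simp
  simp only [PiLp.inner_apply, RCLike.inner_apply, conj_trivial]
  simp_rw [← Finset.sum_add_distrib]
  rw [intervalIntegral.integral_finsetSum, ← Finset.sum_sub_distrib]
  · refine Finset.sum_congr rfl fun i _ => ?_
    have := integral_mul_add_mul_of_primitive hτ (hcoord i hf) (hcoord i hg)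
      (hprim i hf ha) (hprim i hg hb)
    rw [mul_comm (b T i), mul_comm (b τ i), ← this]
    refine intervalIntegral.integral_congr fun s _ => ?_
    simp only
    ring
  · intro i _
    have h1 : ContinuousOn (fun s => a s i) (uIcc τ T) := by
      rw [uIcc_of_le hτ]
      exact (EuclideanSpace.proj (𝕜 := ℝ) i).continuous.comp_continuousOn hac
    have h2 : ContinuousOn (fun s => b s i) (uIcc τ T) := by
      rw [uIcc_of_le hτ]
      exact (EuclideanSpace.proj (𝕜 := ℝ) i).continuous.comp_continuousOn hbc
    exact ((hcoord i hf).continuousOn_mul h2).add ((hcoord i hg).mul_continuousOn h1)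

/-! ### Trajectories and sufficiency of the optimality conditions -/

theorem intervalIntegrable_of_memLp_Ioo {E : Type*} [NormedAddCommGroup E] {u : ℝ → E} {τ T : ℝ}
    (hτ : τ ≤ T) (hu : MemLp u 2 (volume.restrict (Ioo τ T))) :
    IntervalIntegrable u volume τ T := by
  rw [intervalIntegrable_iff_integrableOn_Ioo_of_le hτ]
  exact hu.integrable (by norm_num)

theorem IsLQTrajectory.intervalIntegrable {n p : ℕ} {A : Matrix (Fin n) (Fin n) ℝ}
    {B : Matrix (Fin n) (Fin p) ℝ} {τ T : ℝ} {ξ : EuclideanSpace ℝ (Fin n)}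
    {u : ℝ → EuclideanSpace ℝ (Fin p)} {x : ℝ → EuclideanSpace ℝ (Fin n)} (hτ : τ ≤ T)
    (hu : IntervalIntegrable u volume τ T) (hx : IsLQTrajectory A B τ T ξ u x) :
    IntervalIntegrable (fun s => Matrix.toEuclideanLin A (x s) + Matrix.toEuclideanLin B (u s))
      volume τ T := by
  refine IntervalIntegrable.add (ContinuousOn.intervalIntegrable ?_) ?_
  · rw [uIcc_of_le hτ]
    exact (Matrix.continuous_toEuclideanLin A).comp_continuousOn hx.1
  · exact ⟨(LinearMap.toContinuousLinearMap (Matrix.toEuclideanLin B)).integrable_comp hu.1,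
      (LinearMap.toContinuousLinearMap (Matrix.toEuclideanLin B)).integrable_comp hu.2⟩

theorem IsLQTrajectory.apply_left {n p : ℕ} {A : Matrix (Fin n) (Fin n) ℝ}
    {B : Matrix (Fin n) (Fin p) ℝ} {τ T : ℝ} {ξ : EuclideanSpace ℝ (Fin n)}
    {u : ℝ → EuclideanSpace ℝ (Fin p)} {x : ℝ → EuclideanSpace ℝ (Fin n)} (hτ : τ ≤ T)
    (hx : IsLQTrajectory A B τ T ξ u x) : x τ = ξ := by
  simpa using hx.2 τ ⟨le_rfl, hτ⟩

/-- Pairing a trajectory `x` with a solution `y` of the adjoint equation `y' = -CᵀC w - Aᵀ y`. -/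
theorem IsLQTrajectory.adjoint_pairing {n p m : ℕ} {A : Matrix (Fin n) (Fin n) ℝ}
    {B : Matrix (Fin n) (Fin p) ℝ} (C : Matrix (Fin m) (Fin n) ℝ) {τ T : ℝ}
    {ξ : EuclideanSpace ℝ (Fin n)}
    {u : ℝ → EuclideanSpace ℝ (Fin p)} {x w y : ℝ → EuclideanSpace ℝ (Fin n)} (hτ : τ ≤ T)
    (hu : IntervalIntegrable u volume τ T) (hx : IsLQTrajectory A B τ T ξ u x)
    (hw : Continuous w)
    (hy : ∀ t, HasDerivAt y (-Matrix.toEuclideanLin (C.transpose * C) (w t)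
      - Matrix.toEuclideanLin A.transpose (y t)) t) :
    (∫ s in τ..T, (inner ℝ (Matrix.toEuclideanLin C (w s)) (Matrix.toEuclideanLin C (x s))
        + inner ℝ (-Matrix.toEuclideanLin B.transpose (y s)) (u s)))
      + inner ℝ (y T) (x T) = inner ℝ (y τ) ξ := by
  have hyc : Continuous y := continuous_iff_continuousAt.2 fun t => (hy t).continuousAt
  have hyc' : Continuous fun t => -Matrix.toEuclideanLin (C.transpose * C) (w t)
      - Matrix.toEuclideanLin A.transpose (y t) :=
    (((Matrix.continuous_toEuclideanLin _).comp hw).neg).sub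
      ((Matrix.continuous_toEuclideanLin _).comp hyc)
  have key := integral_inner_add_inner_of_primitive hτ (hyc'.intervalIntegrable τ T)
    (hx.intervalIntegrable hτ hu)
    (fun t _ => by
      rw [intervalIntegral.integral_eq_sub_of_hasDerivAt (fun s _ => hy s)
        (hyc'.intervalIntegrable τ t)]
      abel)
    (fun t ht => by rw [hx.apply_left hτ]; exact hx.2 t ht) hyc.continuousOn hx.1
  rw [hx.apply_left hτ] at key
  have : ∀ s, inner ℝ (Matrix.toEuclideanLin C (w s)) (Matrix.toEuclideanLin C (x s))
        + inner ℝ (-Matrix.toEuclideanLin B.transpose (y s)) (u s)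
      = -(inner ℝ (-Matrix.toEuclideanLin (C.transpose * C) (w s)
        - Matrix.toEuclideanLin A.transpose (y s)) (x s) + inner ℝ (y s)
          (Matrix.toEuclideanLin A (x s) + Matrix.toEuclideanLin B (u s))) := by
    intro s
    simp only [inner_sub_left, inner_neg_left, inner_add_right, Matrix.toEuclideanLin_mul_apply,
      Matrix.inner_toEuclideanLin_left A.transpose, Matrix.inner_toEuclideanLin_left B.transpose,
      Matrix.inner_toEuclideanLin_left C.transpose, Matrix.transpose_transpose]
    ring
  simp_rw [this]
  rw [intervalIntegral.integral_neg, key]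
  ring

/-- A pair `(w, y)` solving the Hamiltonian system of the problem yields an optimal control, and
the optimal cost is `⟨y(τ), ξ⟩`. -/
theorem isLeast_lqCosts {n p m : ℕ} {A : Matrix (Fin n) (Fin n) ℝ}
    {B : Matrix (Fin n) (Fin p) ℝ} {C : Matrix (Fin m) (Fin n) ℝ} {P₀ : Matrix (Fin n) (Fin n) ℝ}
    (hP₀ : P₀.PosSemidef) {τ T : ℝ} (hτ : τ ≤ T) {w y : ℝ → EuclideanSpace ℝ (Fin n)}
    (hw : ∀ t, HasDerivAt w (Matrix.toEuclideanLin A (w t)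
      - Matrix.toEuclideanLin (B * B.transpose) (y t)) t)
    (hy : ∀ t, HasDerivAt y (-Matrix.toEuclideanLin (C.transpose * C) (w t)
      - Matrix.toEuclideanLin A.transpose (y t)) t)
    (hT : y T = Matrix.toEuclideanLin P₀ (w T)) :
    IsLeast (lqCosts A B C P₀ τ T (w τ)) (inner ℝ (y τ) (w τ)) := by
  have hwc : Continuous w := continuous_iff_continuousAt.2 fun t => (hw t).continuousAt
  have hyc : Continuous y := continuous_iff_continuousAt.2 fun t => (hy t).continuousAt
  set v : ℝ → EuclideanSpace ℝ (Fin p) := fun s => -Matrix.toEuclideanLin B.transpose (y s) with hv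
  have hvc : Continuous v := ((Matrix.continuous_toEuclideanLin _).comp hyc).neg
  have hCw : Continuous fun s => Matrix.toEuclideanLin C (w s) :=
    (Matrix.continuous_toEuclideanLin _).comp hwc
  have htraj : IsLQTrajectory A B τ T (w τ) v w := by
    refine ⟨hwc.continuousOn, fun t _ => ?_⟩
    have : ∀ s, Matrix.toEuclideanLin A (w s) + Matrix.toEuclideanLin B (v s)
        = Matrix.toEuclideanLin A (w s) - Matrix.toEuclideanLin (B * B.transpose) (y s) := by
      intro s
      rw [hv, Matrix.toEuclideanLin_mul_apply, map_neg, sub_eq_add_neg]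
    simp_rw [this]
    rw [intervalIntegral.integral_eq_sub_of_hasDerivAt (fun s _ => hw s)]
    · abel
    · exact (((Matrix.continuous_toEuclideanLin _).comp hwc).sub
        ((Matrix.continuous_toEuclideanLin _).comp hyc)).intervalIntegrable _ _
  -- Here the optimal trajectory is paired with its own adjoint.
  have hcost : inner ℝ (y τ) (w τ) = lqCost C P₀ τ T w v := by
    rw [← htraj.adjoint_pairing C hτ (hvc.intervalIntegrable _ _) hwc hy, lqCost, hT]
    simp only [real_inner_self_eq_norm_sq, hv]
  refine ⟨⟨v, w, ?_, htraj, hcost⟩, ?_⟩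
  · have : IsFiniteMeasure (volume.restrict (Ioo τ T)) := inferInstance
    obtain ⟨K, hK⟩ := isCompact_Icc.exists_bound_of_continuousOn (hvc.continuousOn (s := Icc τ T))
    refine MemLp.of_bound hvc.aestronglyMeasurable K ?_
    filter_upwards [ae_restrict_mem measurableSet_Ioo] with s hs
    exact hK s (Ioo_subset_Icc_self hs)
  · rintro c ⟨u, x, hu, hx, rfl⟩
    have hui := intervalIntegrable_of_memLp_Ioo hτ hu
    have hpair := hx.adjoint_pairing C hτ hui hwc hy
    have hCx : ContinuousOn (fun s => Matrix.toEuclideanLin C (x s)) (uIcc τ T) := by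
      rw [uIcc_of_le hτ]
      exact (Matrix.continuous_toEuclideanLin _).comp_continuousOn hx.1
    have hu2 : IntervalIntegrable (fun s => ‖u s‖ ^ 2) volume τ T := by
      rw [intervalIntegrable_iff_integrableOn_Ioo_of_le hτ]
      exact hu.integrable_norm_pow (by norm_num)
    have hvu : IntervalIntegrable (fun s => inner ℝ (v s) (u s)) volume τ T := by
      have hsum : (fun s => inner ℝ (v s) (u s)) = ∑ i, fun s => u s i * v s i := by
        ext s
        simp only [PiLp.inner_apply, RCLike.inner_apply, conj_trivial, Finset.sum_apply]
      rw [hsum]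
      refine IntervalIntegrable.sum _ fun i _ => ?_
      have h : IntervalIntegrable (fun s => u s i) volume τ T :=
        ⟨(EuclideanSpace.proj (𝕜 := ℝ) i).integrable_comp hui.1,
          (EuclideanSpace.proj (𝕜 := ℝ) i).integrable_comp hui.2⟩
      exact h.mul_continuousOn ((EuclideanSpace.proj (𝕜 := ℝ) i).continuous.comp hvc).continuousOn
    have i1 : IntervalIntegrable (fun s => ‖Matrix.toEuclideanLin C (x s)‖ ^ 2 + ‖u s‖ ^ 2)
        volume τ T := (hCx.norm.pow 2).intervalIntegrable.add hu2
    have i2 : IntervalIntegrable (fun s => ‖Matrix.toEuclideanLin C (w s)‖ ^ 2 + ‖v s‖ ^ 2)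
        volume τ T := ((hCw.norm.pow 2).add (hvc.norm.pow 2)).intervalIntegrable _ _
    have i3 : IntervalIntegrable (fun s => inner ℝ (Matrix.toEuclideanLin C (w s))
        (Matrix.toEuclideanLin C (x s)) + inner ℝ (v s) (u s)) volume τ T :=
      (hCw.continuousOn.inner hCx).intervalIntegrable.add hvu
    -- The integrand is ‖C(x - w)‖² + ‖u - v‖², expanded.
    have hint : 0 ≤ ∫ s in τ..T, ((‖Matrix.toEuclideanLin C (x s)‖ ^ 2 + ‖u s‖ ^ 2)
        - 2 * (inner ℝ (Matrix.toEuclideanLin C (w s)) (Matrix.toEuclideanLin C (x s))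
          + inner ℝ (v s) (u s)) + (‖Matrix.toEuclideanLin C (w s)‖ ^ 2 + ‖v s‖ ^ 2)) := by
      refine intervalIntegral.integral_nonneg hτ fun s _ => ?_
      have h1 := norm_sub_sq_real (Matrix.toEuclideanLin C (w s)) (Matrix.toEuclideanLin C (x s))
      have h2 := norm_sub_sq_real (v s) (u s)
      nlinarith [sq_nonneg ‖Matrix.toEuclideanLin C (w s) - Matrix.toEuclideanLin C (x s)‖,
        sq_nonneg ‖v s - u s‖]
    rw [intervalIntegral.integral_add (i1.sub (i3.const_mul 2)) i2,
      intervalIntegral.integral_sub i1 (i3.const_mul 2),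
      intervalIntegral.integral_const_mul] at hint
    -- Added to `hint`, this gives J(x,u) - 2K + J(w,v) ≥ 0 with K the cross terms. By `hpair` and
    -- `hcost`, K = ⟨y(τ), w(τ)⟩ = J(w,v), whence J(x,u) ≥ J(w,v).
    have hpos := hP₀.inner_toEuclideanLin_nonneg (x T - w T)
    have hsymm : inner ℝ (Matrix.toEuclideanLin P₀ (x T)) (w T)
        = inner ℝ (Matrix.toEuclideanLin P₀ (w T)) (x T) := by
      have ht : P₀.transpose = P₀ := by
        rw [← Matrix.conjTranspose_eq_transpose_of_trivial]; exact hP₀.1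
      rw [Matrix.inner_toEuclideanLin_left, ht, real_inner_comm]
    rw [map_sub, inner_sub_left, inner_sub_right, inner_sub_right, hsymm] at hpos
    rw [hT] at hpair
    simp only [lqCost] at hcost ⊢
    linarith

theorem Matrix.IsSymm.eq_of_inner_toEuclideanLin_eq {k : ℕ} {Q R : Matrix (Fin k) (Fin k) ℝ}
    (hQ : Q.IsSymm) (hR : R.IsSymm)
    (h : ∀ v, inner ℝ (Matrix.toEuclideanLin Q v) v = inner ℝ (Matrix.toEuclideanLin R v) v) :
    Q = R := by
  have hs : (Matrix.toEuclideanLin (Q - R)).IsSymmetric := fun v w => by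
    rw [Matrix.inner_toEuclideanLin_left, Matrix.transpose_sub, hQ.eq, hR.eq]
  have h0 : Matrix.toEuclideanLin (Q - R) = 0 := hs.inner_map_self_eq_zero.1 fun v => by
    rw [map_sub, LinearMap.sub_apply, inner_sub_left, h, sub_self]
  exact sub_eq_zero.1 (Matrix.toEuclideanLin.map_eq_zero_iff.1 h0)

/-! ### The Hamiltonian system and the Riccati equation -/

section MatrixNorm

open scoped Matrix.Norms.Operator

theorem HasDerivAt.matrix_apply {k l : ℕ} {M : ℝ → Matrix (Fin k) (Fin l) ℝ}
    {M' : Matrix (Fin k) (Fin l) ℝ} {t : ℝ} (h : HasDerivAt M M' t) (i : Fin k) (j : Fin l) :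
    HasDerivAt (fun s => M s i j) (M' i j) t :=
  (LinearMap.toContinuousLinearMap
    (Matrix.entryLinearMap ℝ ℝ i j)).hasFDerivAt.comp_hasDerivAt t h

theorem HasDerivAt.matrix_inv {k : ℕ} {M : ℝ → Matrix (Fin k) (Fin k) ℝ}
    {M' : Matrix (Fin k) (Fin k) ℝ} {t : ℝ} (h : HasDerivAt M M' t) (hM : IsUnit (M t)) :
    HasDerivAt (fun s => (M s)⁻¹) (-((M t)⁻¹ * M' * (M t)⁻¹)) t := by
  obtain ⟨U, hU⟩ := hM
  have hF := hasFDerivAt_ringInverse (𝕜 := ℝ) U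
  rw [hU] at hF
  have := hF.comp_hasDerivAt t h
  simp_rw [Matrix.nonsing_inv_eq_ringInverse, ← hU, Ring.inverse_unit]
  exact this

/-- A linear differential equation with constant coefficients in finite dimension has a solution
with prescribed value at a given time. -/
theorem exists_hasDerivAt_linear {E : Type*} [NormedAddCommGroup E] [NormedSpace ℝ E]
    [FiniteDimensional ℝ E] (L : E →ₗ[ℝ] E) (T : ℝ) (z : E) :
    ∃ f : ℝ → E, f T = z ∧ ∀ t, HasDerivAt f (L (f t)) t := by
  have : CompleteSpace E := FiniteDimensional.complete ℝ E
  let L' : E →L[ℝ] E := LinearMap.toContinuousLinearMap L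
  refine ⟨fun t => NormedSpace.exp ((t - T) • L') z, by simp, fun t => ?_⟩
  have h1 := (hasDerivAt_exp_smul_const' (𝕂 := ℝ) L' (t - T)).comp_sub_const t T
  have := h1.clm_apply (hasDerivAt_const t z)
  simpa [L'] using this

/-- The Hamiltonian system of the linear quadratic problem. -/
theorem exists_hamiltonian_solution {n p m : ℕ} (A : Matrix (Fin n) (Fin n) ℝ)
    (B : Matrix (Fin n) (Fin p) ℝ) (C : Matrix (Fin m) (Fin n) ℝ) (P₀ : Matrix (Fin n) (Fin n) ℝ)
    (T : ℝ) : ∃ X Y : ℝ → Matrix (Fin n) (Fin n) ℝ, X T = 1 ∧ Y T = P₀ ∧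
      (∀ t, HasDerivAt X (A * X t - B * B.transpose * Y t) t) ∧
      ∀ t, HasDerivAt Y (-(C.transpose * C * X t) - A.transpose * Y t) t := by
  let L : Matrix (Fin n) (Fin n) ℝ × Matrix (Fin n) (Fin n) ℝ →ₗ[ℝ]
      Matrix (Fin n) (Fin n) ℝ × Matrix (Fin n) (Fin n) ℝ :=
    { toFun := fun Z => (A * Z.1 - B * B.transpose * Z.2,
        -(C.transpose * C * Z.1) - A.transpose * Z.2)
      map_add' := fun Z W => by
        ext1 <;> simp only [Prod.fst_add, Prod.snd_add, mul_add] <;> abel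
      map_smul' := fun c Z => by
        ext1 <;> simp [smul_sub] }
  obtain ⟨f, hfT, hf⟩ := exists_hasDerivAt_linear L T (1, P₀)
  refine ⟨fun t => (f t).1, fun t => (f t).2, by simp [hfT], by simp [hfT], fun t => ?_, fun t => ?_⟩
  · exact (ContinuousLinearMap.fst ℝ _ _).hasFDerivAt.comp_hasDerivAt t (hf t)
  · exact (ContinuousLinearMap.snd ℝ _ _).hasFDerivAt.comp_hasDerivAt t (hf t)

theorem hasDerivAt_transpose {k l : ℕ} {M : ℝ → Matrix (Fin k) (Fin l) ℝ}
    {M' : Matrix (Fin k) (Fin l) ℝ} {t : ℝ} (h : HasDerivAt M M' t) :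
    HasDerivAt (fun s => (M s).transpose) M'.transpose t :=
  (LinearMap.toContinuousLinearMap
    (Matrix.transposeLinearEquiv (Fin k) (Fin l) ℝ ℝ).toLinearMap).hasFDerivAt.comp_hasDerivAt t h

/-- `Xᵀ Y` is symmetric along the Hamiltonian flow. -/
theorem hamiltonian_transpose_mul_isSymm {n p m : ℕ} {A : Matrix (Fin n) (Fin n) ℝ}
    {B : Matrix (Fin n) (Fin p) ℝ} {C : Matrix (Fin m) (Fin n) ℝ} {P₀ : Matrix (Fin n) (Fin n) ℝ}
    (hP₀ : P₀.IsSymm) {T : ℝ} {X Y : ℝ → Matrix (Fin n) (Fin n) ℝ} (hXT : X T = 1) (hYT : Y T = P₀)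
    (hX : ∀ t, HasDerivAt X (A * X t - B * B.transpose * Y t) t)
    (hY : ∀ t, HasDerivAt Y (-(C.transpose * C * X t) - A.transpose * Y t) t) (t : ℝ) :
    ((X t).transpose * Y t).IsSymm := by
  -- The terms in A cancel, and so do those in BBᵀ and CᵀC, which are symmetric. The constant value
  -- is P₀ - P₀ᵀ = 0, read off at T.
  have hd : ∀ s, HasDerivAt (fun s => (X s).transpose * Y s - (Y s).transpose * X s) 0 s := by
    intro s
    have := ((hasDerivAt_transpose (hX s)).mul (hY s)).sub
      ((hasDerivAt_transpose (hY s)).mul (hX s))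
    refine this.congr_deriv ?_
    simp only [Matrix.transpose_sub, Matrix.transpose_neg, Matrix.transpose_mul,
      Matrix.transpose_transpose]
    noncomm_ring
  have hc : (X t).transpose * Y t - (Y t).transpose * X t
      = (X T).transpose * Y T - (Y T).transpose * X T :=
    is_const_of_deriv_eq_zero (fun s => (hd s).differentiableAt) (fun s => (hd s).deriv) t T
  rw [hXT, hYT, hP₀.eq] at hc
  rw [Matrix.IsSymm, Matrix.transpose_mul, Matrix.transpose_transpose]
  simpa [sub_eq_zero, eq_comm] using hc

/-- If X(t)v = 0, put x = Xv and y = Yv. Then ⟨x, y⟩ is nonincreasing, zero at t and equal to ⟨P₀v,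
v⟩ ≥ 0 at T, so it vanishes on [t,T]. Hence Bᵀy = 0 there, x solves x' = Ax from x(t) = 0, and v =
x(T) = 0. -/
theorem hamiltonian_isUnit {n p m : ℕ} {A : Matrix (Fin n) (Fin n) ℝ}
    {B : Matrix (Fin n) (Fin p) ℝ} {C : Matrix (Fin m) (Fin n) ℝ} {P₀ : Matrix (Fin n) (Fin n) ℝ}
    (hP₀ : P₀.PosSemidef) {T : ℝ} {X Y : ℝ → Matrix (Fin n) (Fin n) ℝ}
    (hXT : X T = 1) (hYT : Y T = P₀)
    (hX : ∀ t, HasDerivAt X (A * X t - B * B.transpose * Y t) t)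
    (hY : ∀ t, HasDerivAt Y (-(C.transpose * C * X t) - A.transpose * Y t) t)
    {t : ℝ} (ht : t ≤ T) : IsUnit (X t) := by
  rw [Matrix.isUnit_iff_isUnit_det, isUnit_iff_ne_zero]
  intro hdet
  obtain ⟨v₀, hv₀, hXv⟩ := Matrix.exists_mulVec_eq_zero_iff.2 hdet
  set v : EuclideanSpace ℝ (Fin n) := WithLp.toLp 2 v₀ with hv
  set x := fun s => Matrix.toEuclideanLin (X s) v with hx
  set y := fun s => Matrix.toEuclideanLin (Y s) v with hy
  have hx0 : x t = 0 := by
    simp [hx, hv, Matrix.toLpLin_apply, hXv]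
  have hxT : x T = v := by simp only [hx, hXT, Matrix.toEuclideanLin_one_apply]
  have hyT : y T = Matrix.toEuclideanLin P₀ v := by simp only [hy, hYT]
  have hx' : ∀ s, HasDerivAt x (Matrix.toEuclideanLin A (x s)
      - Matrix.toEuclideanLin B (Matrix.toEuclideanLin B.transpose (y s))) s := fun s => by
    simpa only [map_sub, LinearMap.sub_apply, Matrix.toEuclideanLin_mul_apply] using
      Matrix.hasDerivAt_toEuclideanLin_apply (hX s).matrix_apply v
  have hy' : ∀ s, HasDerivAt y (-Matrix.toEuclideanLin C.transpose (Matrix.toEuclideanLin C (x s))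
      - Matrix.toEuclideanLin A.transpose (y s)) s := fun s => by
    simpa only [map_sub, map_neg, LinearMap.neg_apply, LinearMap.sub_apply,
      Matrix.toEuclideanLin_mul_apply] using
      Matrix.hasDerivAt_toEuclideanLin_apply (hY s).matrix_apply v
  have hg : ∀ s, HasDerivAt (fun s => inner ℝ (x s) (y s))
      (-(‖Matrix.toEuclideanLin B.transpose (y s)‖ ^ 2 + ‖Matrix.toEuclideanLin C (x s)‖ ^ 2))
      s := fun s => by
    refine ((hx' s).inner ℝ (hy' s)).congr_deriv ?_
    rw [← real_inner_self_eq_norm_sq, ← real_inner_self_eq_norm_sq, inner_sub_right,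
      inner_neg_right, inner_sub_left, Matrix.inner_toEuclideanLin_left A,
      Matrix.inner_toEuclideanLin_left B, ← Matrix.inner_toEuclideanLin_left C]
    ring
  have hanti : Antitone fun s => inner ℝ (x s) (y s) :=
    antitone_of_hasDerivAt_nonpos hg fun s => by
      simp only [Pi.zero_apply, Left.neg_nonpos_iff]
      positivity
  have hTpos : 0 ≤ inner ℝ (x T) (y T) := by
    rw [hxT, hyT, real_inner_comm]
    exact hP₀.inner_toEuclideanLin_nonneg v
  have hzero : ∀ s ∈ Icc t T, inner ℝ (x s) (y s) = 0 := fun s hs =>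
    le_antisymm ((hanti hs.1).trans_eq (by simp [hx0])) (hTpos.trans (hanti hs.2))
  -- The half-open interval forces t < T, so that derivatives within [t,T] are unique.
  have hBy : ∀ s ∈ Ico t T, Matrix.toEuclideanLin B.transpose (y s) = 0 := by
    intro s hs
    have h1 := (hg s).hasDerivWithinAt (s := Icc t T)
    have h2 : HasDerivWithinAt (fun s => inner ℝ (x s) (y s)) 0 (Icc t T) s :=
      (hasDerivWithinAt_const s (Icc t T) (0 : ℝ)).congr hzero
        (hzero s (Ico_subset_Icc_self hs))
    have h3 := (uniqueDiffOn_Icc (hs.1.trans_lt hs.2) s (Ico_subset_Icc_self hs)).eq_deriv _ h1 h2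
    rw [← norm_eq_zero, ← sq_eq_zero_iff]
    nlinarith [sq_nonneg ‖Matrix.toEuclideanLin B.transpose (y s)‖,
      sq_nonneg ‖Matrix.toEuclideanLin C (x s)‖]
  have huniq := ODE_solution_unique (f := x) (g := fun _ => 0) (a := t) (b := T)
    (v := fun _ => LinearMap.toContinuousLinearMap (Matrix.toEuclideanLin A))
    (fun _ => ContinuousLinearMap.lipschitz _)
    (fun s _ => (hx' s).continuousAt.continuousWithinAt)
    (fun s hs => by
      have := (hx' s).hasDerivWithinAt (s := Ici s)
      simpa [hBy s hs] using this)
    continuousOn_const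
    (fun s _ => by simpa using hasDerivWithinAt_const s (Ici s) (0 : EuclideanSpace ℝ (Fin n)))
    (by simp [hx0])
  have hvz : v = 0 := hxT ▸ huniq ⟨ht, le_rfl⟩
  exact hv₀ (by simpa [hv] using hvz)

/-- The matrix `Y X⁻¹` built from a solution of the Hamiltonian system solves the Riccati
equation. -/
theorem hasDerivAt_riccati {n p m : ℕ} {A : Matrix (Fin n) (Fin n) ℝ}
    {B : Matrix (Fin n) (Fin p) ℝ} {C : Matrix (Fin m) (Fin n) ℝ}
    {X Y : ℝ → Matrix (Fin n) (Fin n) ℝ} {t : ℝ}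
    (hX : HasDerivAt X (A * X t - B * B.transpose * Y t) t)
    (hY : HasDerivAt Y (-(C.transpose * C * X t) - A.transpose * Y t) t) (hu : IsUnit (X t)) :
    HasDerivAt (fun s => Y s * (X s)⁻¹) (-(Y t * (X t)⁻¹ * A + A.transpose * (Y t * (X t)⁻¹)
      - Y t * (X t)⁻¹ * B * B.transpose * (Y t * (X t)⁻¹) + C.transpose * C)) t := by
  refine (hY.mul (hX.matrix_inv hu)).congr_deriv ?_
  have h1 : X t * (X t)⁻¹ = 1 := Matrix.mul_nonsing_inv _ ((Matrix.isUnit_iff_isUnit_det _).1 hu)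
  have e1 : (-(C.transpose * C * X t) - A.transpose * Y t) * (X t)⁻¹
      = -(C.transpose * C * (X t * (X t)⁻¹)) - A.transpose * (Y t * (X t)⁻¹) := by
    simp only [sub_mul, neg_mul, mul_assoc]
  have e2 : (X t)⁻¹ * (A * X t - B * B.transpose * Y t) * (X t)⁻¹
      = (X t)⁻¹ * A * (X t * (X t)⁻¹) - (X t)⁻¹ * (B * B.transpose) * (Y t * (X t)⁻¹) := by
    simp only [mul_sub, sub_mul, mul_assoc]
  rw [e1, e2, h1]
  simp only [mul_one, Matrix.mul_assoc, mul_sub, mul_neg]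
  abel

/-- P is known only on S, so only derivatives within S make sense; this covers the end points. -/
theorem riccati_of_eqOn {n p m : ℕ} {A : Matrix (Fin n) (Fin n) ℝ}
    {B : Matrix (Fin n) (Fin p) ℝ} {C : Matrix (Fin m) (Fin n) ℝ}
    {X Y P : ℝ → Matrix (Fin n) (Fin n) ℝ} {S : Set ℝ} (hS : UniqueDiffOn ℝ S) {t : ℝ} (ht : t ∈ S)
    (hX : HasDerivAt X (A * X t - B * B.transpose * Y t) t)
    (hY : HasDerivAt Y (-(C.transpose * C * X t) - A.transpose * Y t) t) (hu : IsUnit (X t))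
    (hP : ∀ s ∈ S, P s = Y s * (X s)⁻¹) :
    DifferentiableWithinAt ℝ P S t ∧
      derivWithin P S t + P t * A + A.transpose * P t
        - P t * B * B.transpose * P t + C.transpose * C = 0 := by
  have h := (hasDerivAt_riccati hX hY hu).hasDerivWithinAt.congr hP (hP t ht)
  rw [← hP t ht] at h
  refine ⟨h.differentiableWithinAt, ?_⟩
  have hd : derivWithin P S t = -(P t * A + A.transpose * P t
      - P t * B * B.transpose * P t + C.transpose * C) := h.derivWithin (hS t ht)
  rw [hd]
  abel

end MatrixNorm

/-! ### Identification of the value matrix -/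

theorem isLQValueMatrix_hamiltonian {n p m : ℕ} {A : Matrix (Fin n) (Fin n) ℝ}
    {B : Matrix (Fin n) (Fin p) ℝ} {C : Matrix (Fin m) (Fin n) ℝ} {P₀ : Matrix (Fin n) (Fin n) ℝ}
    (hP₀ : P₀.PosSemidef) {T : ℝ} {X Y : ℝ → Matrix (Fin n) (Fin n) ℝ}
    (hXT : X T = 1) (hYT : Y T = P₀)
    (hX : ∀ t, HasDerivAt X (A * X t - B * B.transpose * Y t) t)
    (hY : ∀ t, HasDerivAt Y (-(C.transpose * C * X t) - A.transpose * Y t) t)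
    {τ : ℝ} (hτ : τ ≤ T) : IsLQValueMatrix A B C P₀ τ T (Y τ * (X τ)⁻¹) := by
  have hdet := (Matrix.isUnit_iff_isUnit_det _).1 (hamiltonian_isUnit hP₀ hXT hYT hX hY hτ)
  have h1 : X τ * (X τ)⁻¹ = 1 := Matrix.mul_nonsing_inv _ hdet
  constructor
  · have hs := hamiltonian_transpose_mul_isSymm (by
      rw [Matrix.IsSymm, ← Matrix.conjTranspose_eq_transpose_of_trivial]; exact hP₀.1)
      hXT hYT hX hY τ
    have h2 : (X τ)⁻¹.transpose * (X τ).transpose = 1 := by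
      rw [← Matrix.transpose_mul, h1, Matrix.transpose_one]
    have he : Y τ * (X τ)⁻¹ = (X τ)⁻¹.transpose * ((X τ).transpose * Y τ) * (X τ)⁻¹ := by
      rw [← Matrix.mul_assoc, h2, Matrix.one_mul]
    rw [he, Matrix.IsSymm, Matrix.transpose_mul, Matrix.transpose_mul, hs.eq,
      Matrix.transpose_transpose, Matrix.mul_assoc, Matrix.mul_assoc, Matrix.mul_assoc]
  · intro ξ
    have hw : ∀ v t, HasDerivAt (fun s => Matrix.toEuclideanLin (X s) v)
        (Matrix.toEuclideanLin A (Matrix.toEuclideanLin (X t) v)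
          - Matrix.toEuclideanLin (B * B.transpose) (Matrix.toEuclideanLin (Y t) v)) t :=
      fun v t => by
        simpa only [map_sub, LinearMap.sub_apply, Matrix.toEuclideanLin_mul_apply] using
          Matrix.hasDerivAt_toEuclideanLin_apply (hX t).matrix_apply v
    have hy : ∀ v t, HasDerivAt (fun s => Matrix.toEuclideanLin (Y s) v)
        (-Matrix.toEuclideanLin (C.transpose * C) (Matrix.toEuclideanLin (X t) v)
          - Matrix.toEuclideanLin A.transpose (Matrix.toEuclideanLin (Y t) v)) t :=
      fun v t => by
        simpa only [map_sub, map_neg, LinearMap.neg_apply, LinearMap.sub_apply,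
          Matrix.toEuclideanLin_mul_apply] using
          Matrix.hasDerivAt_toEuclideanLin_apply (hY t).matrix_apply v
    -- The vector X(τ)⁻¹ξ is chosen so that the path passes through ξ at time τ.
    have hmin := isLeast_lqCosts hP₀ hτ (hw (Matrix.toEuclideanLin (X τ)⁻¹ ξ))
      (hy (Matrix.toEuclideanLin (X τ)⁻¹ ξ))
      (by simp only [hXT, hYT, Matrix.toEuclideanLin_one_apply])
    simp only [← Matrix.toEuclideanLin_mul_apply, h1, Matrix.toEuclideanLin_one_apply] at hmin
    exact hmin.isGLB

theorem IsLQValueMatrix.unique {n p m : ℕ} {A : Matrix (Fin n) (Fin n) ℝ}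
    {B : Matrix (Fin n) (Fin p) ℝ} {C : Matrix (Fin m) (Fin n) ℝ} {P₀ : Matrix (Fin n) (Fin n) ℝ}
    {τ T : ℝ} {Q R : Matrix (Fin n) (Fin n) ℝ} (hQ : IsLQValueMatrix A B C P₀ τ T Q)
    (hR : IsLQValueMatrix A B C P₀ τ T R) : Q = R :=
  hQ.1.eq_of_inner_toEuclideanLin_eq hR.1 fun v => (hQ.2 v).unique (hR.2 v)

theorem corollary9p1 {n p m : ℕ} (A : Matrix (Fin n) (Fin n) ℝ) (B : Matrix (Fin n) (Fin p) ℝ)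
    (C : Matrix (Fin m) (Fin n) ℝ) (P₀ : Matrix (Fin n) (Fin n) ℝ) (hP₀ : P₀.PosSemidef)
    (T : ℝ) (hT : 0 < T) :
    (∀ τ ∈ Icc 0 T, ∃! Q : Matrix (Fin n) (Fin n) ℝ, IsLQValueMatrix A B C P₀ τ T Q) ∧
    ∀ P : ℝ → Matrix (Fin n) (Fin n) ℝ,
      (∀ τ ∈ Icc 0 T, IsLQValueMatrix A B C P₀ τ T (P τ)) →
        DifferentiableOn ℝ P (Icc 0 T) ∧
        (∀ t ∈ Icc 0 T,
          derivWithin P (Icc 0 T) t + P t * A + A.transpose * P t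
            - P t * B * B.transpose * P t + C.transpose * C = 0) ∧
        P T = P₀ := by
  obtain ⟨X, Y, hXT, hYT, hX, hY⟩ := exists_hamiltonian_solution A B C P₀ T
  have hval := fun τ (hτ : τ ∈ Icc 0 T) =>
    isLQValueMatrix_hamiltonian hP₀ hXT hYT hX hY hτ.2
  refine ⟨fun τ hτ => ⟨_, hval τ hτ, fun R hR => hR.unique (hval τ hτ)⟩, fun P hP => ?_⟩
  have hPeq : ∀ t ∈ Icc 0 T, P t = Y t * (X t)⁻¹ := fun t ht => (hP t ht).unique (hval t ht)
  have hric := fun t (ht : t ∈ Icc 0 T) => riccati_of_eqOn (uniqueDiffOn_Icc hT) ht (hX t) (hY t)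
    (hamiltonian_isUnit hP₀ hXT hYT hX hY ht.2) hPeq
  refine ⟨fun t ht => (hric t ht).1, fun t ht => (hric t ht).2, ?_⟩
  rw [hPeq T ⟨hT.le, le_rfl⟩, hXT, hYT, inv_one, mul_one]
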